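/- Let $D$ be a finite digraph and $k\ge 0$ an integer. The cop player has a winning strategy in the $\mathcal S$-DAG cops-and-robber game of size $k$ on $D$ if and only if there is an $\mathcal S$-DAG for $D$ of width at most $k$. If moreover $k\le |V(D)|$, this holds if and only if there is an $\mathcal S$-DAG for $D$ of width exactly $k$. Here the notions are as follows. For $S\subseteq V(D)$ and $v \in V(D)$, $R_S(v)$ denotes the set of vertices reachable from $v$ by a directed path (possibly of length $0$) in $D\setminus S$; it is empty if $v\in S$. We write $\subset$ for strict inclusion. *$\mathcal S$-DAGs.* A separation of $D$ is a pair $(A\to B)$ with $A\cup B=V(D)$ and no edge of $D$ from $B\setminus A$ to $A\setminus B$; $(A\to B)\le(A'\to B')$ means $A\subseteq A'$ and $B\supseteq B'$. For a set of separations $(A_i\to B_i)$ let $\bigvee_i (A_i\to B_i)=(\bigcup_i A_i\to\bigcap_i B_i)$ and $\bigwedge_i (A_i\to B_i)=(\bigcap_i A_i\to\bigcup_i B_i)$. An $\mathcal S$-DAG for $D$ is a pair $(T,\sigma)$, where $T$ is a finite non-empty directed acyclic graph of maximum out-degree at most $2$ and $\sigma$ assigns to each edge of $T$ a separation of $D$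 such that $\sigma(t_1,t_2)\le\sigma(t_2,t_3)$ for all edges $(t_1,t_2),(t_2,t_3)$ of $T$. The top separation $\mathrm{top}(t)$ is $(\emptyset\to V(D))$ if $t$ is a source, and otherwise $\bigvee_{(c,t)\in E(T)}\sigma(c,t)$; the bottom separation $\mathrm{bot}(t)$ is $(V(D)\to\emptyset)$ if $t$ is a sink, and otherwise $\bigwedge_{(t,c)\in E(T)}\mathrm{top}(c)$. If $\mathrm{bot}(t)=(A\to B)$ and $\mathrm{top}(t)=(A'\to B')$, the bag of $t$ is $A\cap B'$. The width of $(T,\sigma)$ is the maximum size of a bag. *The game of size $k$.* Let $\mathcal X$ be the set of all subsets of $V(D)$ of size at most $k$. Cop initiative states are pairs $(X,r)\in\mathcal X\times V(D)$; robber initiative states are $(r,(X,M))$ with $r\in V(D)$, $X\in\mathcal X$, $M\subseteq\mathcal X$ and $|M|\in\{1,2\}$. The robber starts by choosing $r_0\in V(D)$, giving the state $(\emptyset,r_0)$. From $(X,r)$ the cop player may move * to $(r,(X_\bot,\{X'\}))$, where $X'\in\mathcal X$ and $X_\bot=X'\cap X$, if $X'\setminus X\subseteq R_X(r)$, $R_X(r)=R_{X_\bot}(r)$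 and $X'\ne X$; or * to $(r,(X_\bot,\{S_1,S_2\}))$, where $S_1\ne S_2$ are in $\mathcal X$ and $X_\bot=X\cap(S_1\cup S_2)$, if $S_1\cap S_2\subseteq X_\bot$; $R_X(r)=R_{X_\bot}(r)$; for every $w\in R_{X_\bot}(r)\setminus(S_1\cup S_2)$ we have $R_{S_1}(w)\subset R_X(r)$ or $R_{S_2}(w)\subset R_X(r)$; and $R_{S_{3-i}}(w)\subset R_X(r)$ for $i\in\{1,2\}$ and all $w\in S_i\setminus X_\bot$. From $(r,(X_\bot,\{X'\}))$ the robber player chooses $r'\in R_{X_\bot}(r)\setminus X'$, giving $(X',r')$. From $(r,(X_\bot,\{S_1,S_2\}))$ the robber player chooses $r'\in R_{X_\bot}(r)$ and then the cop player chooses $j\in\{1,2\}$ with $r'\notin S_j$ and $R_{S_j}(r')\subset R_{X_\bot}(r)$, giving $(S_j,r')$. A play is a maximal sequence of states following these rules; it is won by the cop player if and only if it has a last state and this is a robber initiative state. A strategy for the cop player is a pair $(f,g)$ of partial functions: $f$ maps a cop initiative state to a legal next state, and $g$ maps a robber initiative state $p = (r,(X,M))$ with $|M|=2$ together with a vertex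 $v$ to an element of $\mathcal X$ such that, for $v\in R_X(r)$, moving from $p$ to $(g(p,v),v)$ is legal. A play is consistent with $(f,g)$ if it follows $f$ and $g$ wherever they are defined. The strategy is winning if every play consistent with it is won by the cop player. -/

import Mathlib

namespace SepDag

universe u

/-- The set of vertices reachable from `v` in the induced subdigraph `D \ S` (empty if `v ∈ S`,
since then `v` is not a vertex of `D \ S`). Paths of length zero are allowed. -/
def reach {V : Type u} (D : Digraph V) (S : Set V) (v : V) : Set V :=
  {w | v ∉ S ∧ Relation.ReflTransGen (fun a b => D.Adj a b ∧ a ∉ S ∧ b ∉ S) v w}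

/-! ### Directed separations -/

/-- A separation `(A → B)` of `D`: the two sides cover the vertex set and no edge leads from
`B \ A` to `A \ B`. -/
@[ext]
structure Separation {V : Type u} (D : Digraph V) where
  A : Set V
  B : Set V
  cover : A ∪ B = Set.univ
  no_edge : ∀ a ∈ A \ B, ∀ b ∈ B \ A, ¬ D.Adj b a

namespace Separation

variable {V : Type u} {D : Digraph V}

/-- `(A → B) ≤ (A' → B')` if `A ⊆ A'` and `B ⊇ B'`. -/
instance : LE (Separation D) := ⟨fun S S' => S.A ⊆ S'.A ∧ S'.B ⊆ S.B⟩

/-- The lower uncrossing `⋀ Z = (⋂ A → ⋃ B)` of a set of separations.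
For `Z = ∅` this is `(V(D) → ∅)`. -/
def meet (Z : Set (Separation D)) : Separation D where
  A := ⋂ S ∈ Z, S.A
  B := ⋃ S ∈ Z, S.B
  cover := by
    refine Set.eq_univ_of_forall fun x => ?_
    by_cases h : ∃ S ∈ Z, x ∈ S.B
    · exact Or.inr (by simpa using h)
    · push Not at h
      refine Or.inl (Set.mem_iInter₂.2 fun S hS => ?_)
      have hx : x ∈ S.A ∪ S.B := S.cover ▸ Set.mem_univ x
      exact hx.resolve_right (h S hS)
  no_edge := by
    rintro a ⟨ha, ha'⟩ b ⟨hb, hb'⟩ hab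
    simp only [Set.mem_iInter, Set.mem_iUnion, not_exists, not_forall] at ha ha' hb hb'
    obtain ⟨S, hS, hbS⟩ := hb'
    have hx : b ∈ S.A ∪ S.B := S.cover ▸ Set.mem_univ b
    exact S.no_edge a ⟨ha S hS, ha' S hS⟩ b ⟨hx.resolve_left hbS, hbS⟩ hab

/-- The upper uncrossing `⋁ Z = (⋃ A → ⋂ B)` of a set of separations.
For `Z = ∅` this is `(∅ → V(D))`. -/
def join (Z : Set (Separation D)) : Separation D where
  A := ⋃ S ∈ Z, S.A
  B := ⋂ S ∈ Z, S.B
  cover := by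
    refine Set.eq_univ_of_forall fun x => ?_
    by_cases h : ∃ S ∈ Z, x ∈ S.A
    · exact Or.inl (by simpa using h)
    · push Not at h
      refine Or.inr (Set.mem_iInter₂.2 fun S hS => ?_)
      have hx : x ∈ S.A ∪ S.B := S.cover ▸ Set.mem_univ x
      exact hx.resolve_left (h S hS)
  no_edge := by
    rintro a ⟨ha, ha'⟩ b ⟨hb, hb'⟩ hab
    simp only [Set.mem_iInter, Set.mem_iUnion, not_exists, not_forall] at ha ha' hb hb'
    obtain ⟨S, hS, haS⟩ := ha'
    have hx : a ∈ S.A ∪ S.B := S.cover ▸ Set.mem_univ a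
    exact S.no_edge a ⟨hx.resolve_right haS, haS⟩ b ⟨hb S hS, hb' S hS⟩ hab

end Separation

/-! ### 𝒮-DAGs -/

/-- An `𝒮`-DAG `(T, σ)` for `D`: a finite nonempty acyclic digraph `T` of maximum out-degree at
most two together with a consistent assignment `σ` of separations of `D` to the edges of `T`. -/
structure SDAG {V : Type u} (D : Digraph V) where
  Node : Type
  [finite_node : Finite Node]
  [nonempty_node : Nonempty Node]
  T : Digraph Node
  acyclic : ∀ t, ¬ Relation.TransGen T.Adj t t
  outDegree_le : ∀ t, {c | T.Adj t c}.ncard ≤ 2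
  σ : ∀ s t, T.Adj s t → Separation D
  consistent : ∀ t₁ t₂ t₃ (h : T.Adj t₁ t₂) (h' : T.Adj t₂ t₃), σ t₁ t₂ h ≤ σ t₂ t₃ h'

namespace SDAG

variable {V : Type u} {D : Digraph V} (G : SDAG D)

/-- The top separation of `t`: the upper uncrossing of the separations on the incoming edges; at
a source this is the empty uncrossing `(∅ → V(D))`. -/
def topSep (t : G.Node) : Separation D :=
  Separation.join {S | ∃ (p : G.Node) (h : G.T.Adj p t), S = G.σ p t h}

/-- The bottom separation of `t`: the lower uncrossing of the top separations of the children; at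
a sink this is the empty uncrossing `(V(D) → ∅)`. -/
def botSep (t : G.Node) : Separation D :=
  Separation.meet {S | ∃ c : G.Node, G.T.Adj t c ∧ S = G.topSep c}

theorem topSep_of_source (t : G.Node) (ht : ∀ p, ¬ G.T.Adj p t) :
    (G.topSep t).A = ∅ ∧ (G.topSep t).B = Set.univ := by
  simp [topSep, Separation.join, ht]

theorem botSep_of_sink (t : G.Node) (ht : ∀ c, ¬ G.T.Adj t c) :
    (G.botSep t).A = Set.univ ∧ (G.botSep t).B = ∅ := by
  simp [botSep, Separation.meet, ht]

/-- The bag of `t`. -/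
def bag (t : G.Node) : Set V := (G.botSep t).A ∩ (G.topSep t).B

/-- The width: the maximum size of a bag (a supremum over the finite nonempty set of nodes). -/
noncomputable def width : ℕ := ⨆ t, (G.bag t).ncard

end SDAG

/-! ### The 𝒮-DAG cops-and-robber game of size `k` -/

/-- The sets of at most `k` vertices. -/
abbrev CopPos (V : Type u) (k : ℕ) : Type u := {S : Set V // S.ncard ≤ k}

/-- Cop initiative game states `(X, r)`. -/
structure CopState (V : Type u) (k : ℕ) where
  cops : CopPos V k
  robber : V

/-- Single separator robber initiative game states `(r, (X, {X'}))`; the one-element set of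
potential cop moves is recorded by its element `next = X'`. -/
structure RobberState₁ (V : Type u) (k : ℕ) where
  robber : V
  cops : CopPos V k
  next : CopPos V k

/-- Double separator robber initiative game states `(r, (X, M))` with `|M| = 2`. -/
structure RobberState₂ (V : Type u) (k : ℕ) where
  robber : V
  cops : CopPos V k
  next : Set (CopPos V k)
  card_next : next.ncard = 2

/-- Robber initiative game states. -/
inductive RobberState (V : Type u) (k : ℕ) where
  | single (q : RobberState₁ V k)
  | double (q : RobberState₂ V k)

/-- All game states. -/
inductive GameState (V : Type u) (k : ℕ) where
  | cop (p : CopState V k)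
  | robber (q : RobberState V k)

section Moves

variable {V : Type u} (D : Digraph V) {k : ℕ}

/-- The cop player moves from `(X, r)` to `(r, (X_⊥, {X'}))`, where `X_⊥ = X' ∩ X`. -/
def IsSingleMove (p : CopState V k) (q : RobberState₁ V k) : Prop :=
  q.robber = p.robber ∧
  q.cops.1 = q.next.1 ∩ p.cops.1 ∧
  q.next.1 \ p.cops.1 ⊆ reach D p.cops.1 p.robber ∧
  reach D p.cops.1 p.robber = reach D q.cops.1 p.robber ∧
  q.next ≠ p.cops

/-- The cop player moves from `(X, r)` to `(r, (X_⊥, {S₁, S₂}))`, where `X_⊥ = X ∩ (S₁ ∪ S₂)`.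
Here `S₁ ≠ S₂`, because `q.next` has exactly two elements. -/
def IsDoubleMove (p : CopState V k) (q : RobberState₂ V k) : Prop :=
  q.robber = p.robber ∧
  ∃ S₁ S₂ : CopPos V k,
    q.next = {S₁, S₂} ∧
    q.cops.1 = p.cops.1 ∩ (S₁.1 ∪ S₂.1) ∧
    S₁.1 ∩ S₂.1 ⊆ q.cops.1 ∧
    reach D p.cops.1 p.robber = reach D q.cops.1 p.robber ∧
    (∀ w ∈ reach D q.cops.1 p.robber \ (S₁.1 ∪ S₂.1),
      reach D S₁.1 w ⊂ reach D p.cops.1 p.robber ∨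
      reach D S₂.1 w ⊂ reach D p.cops.1 p.robber) ∧
    (∀ w ∈ S₁.1 \ q.cops.1, reach D S₂.1 w ⊂ reach D p.cops.1 p.robber) ∧
    (∀ w ∈ S₂.1 \ q.cops.1, reach D S₁.1 w ⊂ reach D p.cops.1 p.robber)

/-- From `(r, (X_⊥, {X'}))` the robber player chooses `r' ∈ Reach_{D \ X_⊥}(r) \ X'`, which yields
`(X', r')`. -/
def IsReply₁ (q : RobberState₁ V k) (p : CopState V k) : Prop :=
  p.robber ∈ reach D q.cops.1 q.robber \ q.next.1 ∧ p.cops = q.next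

/-- From `(r, (X_⊥, {S₁, S₂}))` the robber player chooses `r' ∈ Reach_{D \ X_⊥}(r)` and the cop
player chooses one of the two potential moves `S_j` with `r' ∉ S_j` and
`Reach_{D \ S_j}(r') ⊂ Reach_{D \ X_⊥}(r)`, which yields `(S_j, r')`. -/
def IsReply₂ (q : RobberState₂ V k) (p : CopState V k) : Prop :=
  p.robber ∈ reach D q.cops.1 q.robber ∧
  p.cops ∈ q.next ∧
  p.robber ∉ p.cops.1 ∧
  reach D p.cops.1 p.robber ⊂ reach D q.cops.1 q.robber

/-- Moves of the cop player from a cop initiative game state. -/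
def IsCopMove (p : CopState V k) : RobberState V k → Prop
  | .single q => IsSingleMove D p q
  | .double q => IsDoubleMove D p q

/-- Transitions from a robber initiative game state. -/
def IsReply : RobberState V k → CopState V k → Prop
  | .single q => IsReply₁ D q
  | .double q => IsReply₂ D q

/-- The legal moves between game states. -/
def IsMove : GameState V k → GameState V k → Prop
  | .cop p, .robber q => IsCopMove D p q
  | .robber q, .cop p => IsReply D q p
  | .cop _, .cop _ => False
  | .robber _, .robber _ => False

/-- The game state `(∅, r)` that results from the first move of the robber player. -/
def startState (k : ℕ) (r : V) : GameState V k :=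
  .cop ⟨⟨∅, by simp⟩, r⟩

/-- A play: a maximal sequence of game states that starts with `(∅, r₀)` and follows the rules.
A sequence is encoded as `π : ℕ → Option (GameState V k)`, with value `none` after its end (if it
ends), so infinite sequences are not excluded by definition. -/
structure IsPlay (π : ℕ → Option (GameState V k)) : Prop where
  start : ∃ r₀ : V, π 0 = some (startState k r₀)
  step : ∀ n p q, π n = some p → π (n + 1) = some q → IsMove D p q
  maximal : ∀ n p, π n = some p → π (n + 1) = none → ∀ q, ¬ IsMove D p q
  ended : ∀ n, π n = none → π (n + 1) = none

/-- A play is winning for the cop player if it has a last game state and this is a robber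
initiative game state. -/
def CopsWinPlay (π : ℕ → Option (GameState V k)) : Prop :=
  ∃ n q, π n = some (.robber q) ∧ π (n + 1) = none

/-- A strategy `(f, g)` for the cop player; `none` encodes that a partial function is undefined. -/
structure Strategy (k : ℕ) where
  f : CopState V k → Option (RobberState V k)
  g : RobberState₂ V k → V → Option (CopPos V k)
  legal_f : ∀ p q, f p = some q → IsCopMove D p q
  legal_g : ∀ q, ∀ v ∈ reach D q.cops.1 q.robber, ∀ S,
    g q v = some S → IsReply₂ D q ⟨S, v⟩

/-- The play `π` is consistent with the strategy `(f, g)`. -/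
structure Strategy.Consistent {D : Digraph V} (s : Strategy D k)
    (π : ℕ → Option (GameState V k)) : Prop where
  follows_f : ∀ n p q, π n = some (.cop p) → s.f p = some q → π (n + 1) = some (.robber q)
  follows_g : ∀ n q p S, π n = some (.robber (.double q)) → π (n + 1) = some (.cop p) →
    s.g q p.robber = some S → p.cops = S

/-- A strategy is winning if every play consistent with it is winning for the cop player. -/
def Strategy.Winning {D : Digraph V} (s : Strategy D k) : Prop :=
  ∀ π, IsPlay D π → s.Consistent π → CopsWinPlay π

/-- The cop player has a winning strategy in the game of size `k` on `D`. -/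
def CopsWin (k : ℕ) : Prop := ∃ s : Strategy D k, s.Winning

end Moves

end SepDag

/-! Game and `𝒮`-DAG are compared through `Decomposable k S`, a binary tree of separations growing
from `S` to `(V → ∅)` with bags of size at most `k`. A width-`k` `𝒮`-DAG unfolds into such a tree
from `(∅ → V)` by induction from the sinks on top separations, and a tree is an `𝒮`-DAG when every
edge carries the label of its head.

Each round lowers `(k + 1)·|R| + |X|`, where `R` is the robber's territory and `X` the cop set.
Hence plays are finite, and winning strategies amount to the inductive predicate `CopsWinFrom`.

A tree guides the cops (`copsWinFrom_of_node`): they keep the robber outside `S.A`, occupy the bag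
where it meets `R`, and then use a double move to push him past one of the children. Conversely, a
winning state `(X, r)` gives the separation `(V \ R → R ∪ X)`, which is decomposable by induction on
the win (`CopsWinFrom.decomposable`); several territories behind the same cops are merged by binary
nodes with bags inside the cop set.

For exact width, a set `Y` is added to both sides of all separations. This adds `Y` to every bag, so
growing `Y` vertex by vertex raises the width in steps of at most one, up to `|V|`. -/

namespace SepDag

universe v

/-! ### Reachability and out-boundaries -/

section Reach

variable {V : Type v} {D : Digraph V} {S X Y U : Set V} {u w x : V}

theorem mem_reach_self (h : w ∉ S) : w ∈ reach D S w := ⟨h, .refl⟩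

theorem not_mem_of_mem_reach (h : u ∈ reach D S w) : u ∉ S := by
  obtain ⟨h₀, h⟩ := h
  cases h with
  | refl => exact h₀
  | tail _ h => exact h.2.2

theorem reach_closed (h : u ∈ reach D S w) (ha : D.Adj u x) (hx : x ∉ S) : x ∈ reach D S w :=
  ⟨h.1, h.2.tail ⟨ha, not_mem_of_mem_reach h, hx⟩⟩

theorem reach_subset (hw : w ∈ U) (hU : ∀ u ∈ U, ∀ x, D.Adj u x → x ∈ U ∨ x ∈ S) :
    reach D S w ⊆ U := by
  rintro y ⟨-, h⟩
  induction h with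
  | refl => exact hw
  | tail _ h ih => exact (hU _ ih _ h.1).resolve_right h.2.2

theorem reach_anti (h : Y ⊆ X) : reach D X w ⊆ reach D Y w := by
  rintro y ⟨h₀, hy⟩
  exact ⟨fun h' => h₀ (h h'), Relation.ReflTransGen.mono
    (fun a b hab => ⟨hab.1, fun h' => hab.2.1 (h h'), fun h' => hab.2.2 (h h')⟩) _ _ hy⟩

theorem reach_trans (h : u ∈ reach D S w) : reach D S u ⊆ reach D S w :=
  fun _ hx => ⟨h.1, h.2.trans hx.2⟩

/-- The set of vertices outside `U` that are out-neighbours of vertices of `U`. -/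
def outBoundary (D : Digraph V) (U : Set V) : Set V := {x | x ∉ U ∧ ∃ u ∈ U, D.Adj u x}

theorem outBoundary_reach_subset : outBoundary D (reach D X w) ⊆ X := by
  rintro x ⟨hx, u, hu, ha⟩
  by_contra h
  exact hx (reach_closed hu ha h)

/-- Only cops on the out-boundary of the robber's territory restrict him; the others may leave
without enlarging it. -/
theorem reach_eq_of_outBoundary_subset (hw : w ∉ X) (hYX : Y ⊆ X)
    (h : outBoundary D (reach D X w) ⊆ Y) : reach D X w = reach D Y w := by
  refine (reach_anti hYX).antisymm (reach_subset (mem_reach_self hw) fun u hu x ha => ?_)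
  by_cases hx : x ∈ reach D X w
  · exact .inl hx
  · exact .inr (h ⟨hx, u, hu, ha⟩)

theorem reach_subset_of_mem (hw : w ∈ U) (h : outBoundary D U ⊆ S) : reach D S w ⊆ U := by
  refine reach_subset hw fun u hu x ha => ?_
  by_cases hx : x ∈ U
  · exact .inl hx
  · exact .inr (h ⟨hx, u, hu, ha⟩)

end Reach

/-! ### Edges across separations, extreme separations -/

namespace Separation

variable {V : Type v} {D : Digraph V}

theorem mem_B_of_adj (S : Separation D) {u x : V} (hu : u ∉ S.A) (h : D.Adj u x) : x ∈ S.B := by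
  have c : ∀ y, y ∈ S.A ∨ y ∈ S.B := fun y => by
    have : y ∈ S.A ∪ S.B := S.cover ▸ Set.mem_univ y
    exact this
  by_contra hx
  exact S.no_edge x ⟨(c x).resolve_right hx, hx⟩ u ⟨(c u).resolve_left hu, hu⟩ h

theorem mem_B_of_not_mem_A (S : Separation D) {u : V} (hu : u ∉ S.A) : u ∈ S.B := by
  have : u ∈ S.A ∪ S.B := S.cover ▸ Set.mem_univ u
  exact this.resolve_left hu

theorem self_le (S : Separation D) : S ≤ S := ⟨subset_rfl, subset_rfl⟩

/-- The greatest separation `(V(D) → ∅)`. -/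
def last (D : Digraph V) : Separation D where
  A := Set.univ
  B := ∅
  cover := by simp
  no_edge := by simp

/-- The least separation `(∅ → V(D))`. -/
def first (D : Digraph V) : Separation D where
  A := ∅
  B := Set.univ
  cover := by simp
  no_edge := by simp

theorem le_last (S : Separation D) : S ≤ last D := ⟨Set.subset_univ _, Set.empty_subset _⟩

/-- The separation `(V \ U → U ∪ X)` where `X` contains all out-neighbours of `U`. -/
def ofRegion (U X : Set V) (h : outBoundary D U ⊆ X) : Separation D where
  A := Uᶜ
  B := U ∪ X
  cover := by
    ext x
    by_cases hx : x ∈ U <;> simp [hx]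
  no_edge := by
    rintro a ⟨ha, ha'⟩ b ⟨_, hb⟩ hab
    exact ha' (.inr (h ⟨ha, b, not_not.1 hb, hab⟩))

end Separation

/-! ### Decompositions as an inductive predicate -/

open Separation in
/-- `Decomposable k S` means that a binary tree with root separation `S` and with bags of size at
most `k` exists. -/
inductive Decomposable {V : Type v} {D : Digraph V} (k : ℕ) : Separation D → Prop
  | last : Decomposable k (last D)
  | node (S S₁ S₂ : Separation D) : S ≤ S₁ → S ≤ S₂ → Decomposable k S₁ → Decomposable k S₂ →
      (S₁.A ∩ S₂.A ∩ S.B).ncard ≤ k → Decomposable k S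

section Decomposable

variable {V : Type v} {D : Digraph V} {k : ℕ}

/-- `S.A` lies in the upper sides of both children, so `S.A ∩ S.B` is part of the root bag. This
bounds the cop sets used in double moves. -/
theorem Decomposable.order_le [Finite V] {S : Separation D} (h : Decomposable k S) :
    (S.A ∩ S.B).ncard ≤ k := by
  cases h with
  | last => simp [Separation.last]
  | node _ S₁ S₂ h₁ h₂ _ _ hb =>
    refine (Set.ncard_le_ncard ?_ (Set.toFinite _)).trans hb
    exact fun x hx => ⟨⟨h₁.1 hx.1, h₂.1 hx.1⟩, hx.2⟩

/-- A node with one child is encoded by repeating that child. -/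
theorem Decomposable.single {S S₁ : Separation D} (h : S ≤ S₁) (h₁ : Decomposable k S₁)
    (hb : (S₁.A ∩ S.B).ncard ≤ k) : Decomposable k S :=
  .node S S₁ S₁ h h h₁ h₁ (by rwa [Set.inter_self])

/-- A labelled binary tree: `lab l` is the separation at the node with address `l`. -/
structure IsLabelling (k n : ℕ) (S : Separation D) (lab : List Bool → Separation D) : Prop where
  root : lab [] = S
  le : ∀ l b, lab l ≤ lab (l ++ [b])
  bag : ∀ l, ((lab (l ++ [true])).A ∩ (lab (l ++ [false])).A ∩ (lab l).B).ncard ≤ k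
  eventually : ∀ l, n ≤ l.length → lab l = Separation.last D

theorem Decomposable.exists_labelling {S : Separation D} (h : Decomposable k S) :
    ∃ n lab, IsLabelling k n S lab := by
  induction h with
  | last =>
    exact ⟨0, fun _ => Separation.last D, rfl, fun _ _ => Separation.self_le _,
      fun _ => by simp [Separation.last], fun _ _ => rfl⟩
  | node S S₁ S₂ h₁ h₂ _ _ hb ih₁ ih₂ =>
    obtain ⟨n₁, l₁, H₁⟩ := ih₁
    obtain ⟨n₂, l₂, H₂⟩ := ih₂
    refine ⟨max n₁ n₂ + 1, fun l => match l with
      | [] => S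
      | true :: l => l₁ l
      | false :: l => l₂ l, rfl, ?_, ?_, ?_⟩
    · rintro (_ | ⟨_ | _, l⟩) b
      · cases b
        · simpa [H₂.root] using h₂
        · simpa [H₁.root] using h₁
      · exact H₂.le l b
      · exact H₁.le l b
    · rintro (_ | ⟨_ | _, l⟩)
      · simpa [H₂.root, H₁.root] using hb
      · exact H₂.bag l
      · exact H₁.bag l
    · rintro (_ | ⟨_ | _, l⟩) hl
      · simp at hl
      · exact H₂.eventually l (by simp at hl; omega)
      · exact H₁.eventually l (by simp at hl; omega)

theorem SDAG.width_le_iff (G : SDAG D) : G.width ≤ k ↔ ∀ t, (G.bag t).ncard ≤ k := by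
  have := G.finite_node
  have := G.nonempty_node
  exact ciSup_le_iff (Set.finite_range _).bddAbove

/-- The `𝒮`-DAG of a labelled binary tree of depth `n`. -/
def IsLabelling.toSDAG {n : ℕ} {S : Separation D} {lab : List Bool → Separation D}
    (H : IsLabelling k n S lab) : SDAG D where
  Node := {l : List Bool // l.length ≤ n}
  finite_node := (List.finite_length_le Bool n).to_subtype
  nonempty_node := ⟨⟨[], Nat.zero_le _⟩⟩
  T := ⟨fun s t => ∃ b, t.1 = s.1 ++ [b]⟩
  acyclic := by
    have : ∀ s t : {l : List Bool // l.length ≤ n},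
        Relation.TransGen (fun s t => ∃ b, t.1 = s.1 ++ [b]) s t → s.1.length < t.1.length := by
      intro s t h
      induction h with
      | single h => obtain ⟨b, h⟩ := h; simp [h]
      | tail _ h ih => obtain ⟨b, h⟩ := h; simp [h]; omega
    exact fun t h => lt_irrefl _ (this t t h)
  outDegree_le := by
    intro t
    refine (Set.ncard_le_ncard_of_injOn (t := {t.1 ++ [true], t.1 ++ [false]})
      Subtype.val ?_ Subtype.val_injective.injOn (Set.toFinite _)).trans ((Set.ncard_insert_le _ _).trans (by simp))
    rintro c ⟨_ | _, h⟩ <;> simp [h]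
  σ _ t _ := lab t.1
  consistent := by
    rintro t₁ t₂ t₃ - ⟨b, h⟩
    rw [h]
    exact H.le _ b

/-- A non-root node has exactly one parent, so its join is over a single separation; at the root the
empty join is `first D`, whence the assumption on the root label. -/
theorem IsLabelling.topSep_toSDAG {n : ℕ} {lab : List Bool → Separation D}
    (H : IsLabelling k n (Separation.first D) lab) (t : H.toSDAG.Node) :
    H.toSDAG.topSep t = lab t.1 := by
  obtain ⟨l, hl⟩ := t
  rcases List.eq_nil_or_concat l with rfl | ⟨l, b, rfl⟩
  · have h := H.toSDAG.topSep_of_source ⟨[], hl⟩ (by rintro p ⟨b, h⟩; simp at h)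
    rw [H.root]
    exact Separation.ext h.1 h.2
  · have hp : H.toSDAG.T.Adj ⟨l, by simp at hl; omega⟩ ⟨l.concat b, hl⟩ := ⟨b, by simp⟩
    have : {S | ∃ (p : H.toSDAG.Node) (h : H.toSDAG.T.Adj p ⟨l.concat b, hl⟩),
        S = H.toSDAG.σ p ⟨l.concat b, hl⟩ h} = {lab (l.concat b)} := by
      ext S
      exact ⟨fun ⟨_, _, h⟩ => h, fun h => ⟨_, hp, h⟩⟩
    unfold SDAG.topSep
    rw [this]
    ext x <;> simp [Separation.join]

theorem Decomposable.exists_sdag [Finite V] (h : Decomposable k (Separation.first D)) :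
    ∃ G : SDAG D, G.width ≤ k := by
  obtain ⟨n, lab, H⟩ := h.exists_labelling
  refine ⟨H.toSDAG, H.toSDAG.width_le_iff.2 fun t => ?_⟩
  refine (Set.ncard_le_ncard ?_ (Set.toFinite _)).trans (H.bag t.1)
  rintro x ⟨hA, hB⟩
  rw [H.topSep_toSDAG] at hB
  have key : ∀ b, x ∈ (lab (t.1 ++ [b])).A := by
    intro b
    by_cases hl : t.1.length < n
    · have hc : H.toSDAG.T.Adj t ⟨t.1 ++ [b], by simp; omega⟩ := ⟨b, rfl⟩
      have := Set.mem_iInter₂.1 hA _ ⟨_, hc, rfl⟩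
      have h' := H.topSep_toSDAG ⟨t.1 ++ [b], by simp; omega⟩
      exact h' ▸ this
    -- Words of length `n` are sinks; their missing children carry `last D`, whose upper side is
    -- everything.
    · rw [H.eventually _ (by simp; omega)]
      trivial
  exact ⟨⟨key _, key _⟩, hB⟩

/-! ### Unfolding an `𝒮`-DAG into a tree -/

theorem SDAG.topSep_le {G : SDAG D} {s t : G.Node} (h : G.T.Adj s t) :
    G.topSep s ≤ G.topSep t := by
  constructor
  · intro x hx
    obtain ⟨_, ⟨p, hp, rfl⟩, hx⟩ := Set.mem_iUnion₂.1 hx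
    exact Set.mem_iUnion₂.2 ⟨_, ⟨s, h, rfl⟩, (G.consistent p s t hp h).1 hx⟩
  · intro x hx
    refine Set.mem_iInter₂.2 ?_
    rintro _ ⟨p, hp, rfl⟩
    exact (G.consistent p s t hp h).2 (Set.mem_iInter₂.1 hx _ ⟨s, h, rfl⟩)

theorem SDAG.decomposable_topSep (G : SDAG D) (hG : G.width ≤ k) (t : G.Node) :
    Decomposable k (G.topSep t) := by
  have := G.finite_node
  have : IsTrans G.Node (fun a b => Relation.TransGen G.T.Adj b a) := ⟨fun _ _ _ h h' => h'.trans h⟩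
  have : Std.Irrefl (fun a b => Relation.TransGen G.T.Adj b a) := ⟨G.acyclic⟩
  have wf := Finite.wellFounded_of_trans_of_irrefl (fun a b => Relation.TransGen G.T.Adj b a)
  induction t using wf.induction with
  | _ t ih =>
    have hb := G.width_le_iff.1 hG t
    have hfin : {c | G.T.Adj t c}.Finite := Set.toFinite _
    have hc : (G.botSep t).A = ⋂ c ∈ {c | G.T.Adj t c}, (G.topSep c).A := by
      ext x
      simp [botSep, Separation.meet]
    have hch : ∀ c ∈ {c | G.T.Adj t c}, G.topSep t ≤ G.topSep c ∧ Decomposable k (G.topSep c) :=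
      fun c hc => ⟨topSep_le hc, ih c (.single hc)⟩
    unfold bag at hb
    rw [hc] at hb
    have h2 := G.outDegree_le t
    generalize {c | G.T.Adj t c} = C at *
    have : C.ncard = 0 ∨ C.ncard = 1 ∨ C.ncard = 2 := by omega
    rcases this with h | h | h
    · rw [Set.ncard_eq_zero hfin] at h
      subst h
      -- A sink receives the artificial child `last D`, which matches the bottom separation `(V →
      -- ∅)`.
      exact .single (Separation.le_last _) .last (by simpa [Separation.last] using hb)
    · obtain ⟨c, rfl⟩ := Set.ncard_eq_one.1 h
      exact .single (hch c rfl).1 (hch c rfl).2 (by simpa using hb)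
    · obtain ⟨c, d, -, rfl⟩ := Set.ncard_eq_two.1 h
      have h₁ := hch c (by simp)
      have h₂ := hch d (by simp)
      exact .node _ _ _ h₁.1 h₂.1 h₁.2 h₂.2 (by simpa using hb)

theorem SDAG.exists_source (G : SDAG D) : ∃ t, ∀ p, ¬ G.T.Adj p t := by
  have := G.finite_node
  have := G.nonempty_node
  have : IsTrans G.Node (Relation.TransGen G.T.Adj) := ⟨fun _ _ _ h h' => h.trans h'⟩
  have : Std.Irrefl (Relation.TransGen G.T.Adj) := ⟨G.acyclic⟩
  have wf := Finite.wellFounded_of_trans_of_irrefl (Relation.TransGen G.T.Adj)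
  obtain ⟨t, -, ht⟩ := wf.has_min Set.univ Set.univ_nonempty
  exact ⟨t, fun p hp => ht p trivial (.single hp)⟩

theorem exists_sdag_width_le_iff [Finite V] :
    (∃ G : SDAG D, G.width ≤ k) ↔ Decomposable k (Separation.first D) := by
  refine ⟨fun ⟨G, hG⟩ => ?_, fun h => h.exists_sdag⟩
  obtain ⟨t, ht⟩ := G.exists_source
  have h := G.topSep_of_source t ht
  have : G.topSep t = Separation.first D := Separation.ext h.1 h.2
  exact this ▸ G.decomposable_topSep hG t

end Decomposable

/-! ### Enlarging the bags of an `𝒮`-DAG -/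

section Enlarge

variable {V : Type v} {D : Digraph V}

/-- The separation `(A ∪ Y → B ∪ Y)`. -/
def Separation.enlarge (Y : Set V) (S : Separation D) : Separation D where
  A := S.A ∪ Y
  B := S.B ∪ Y
  cover := by
    rw [← Set.union_union_distrib_right, S.cover, Set.univ_union]
  no_edge := by
    rintro a ⟨ha, ha'⟩ b ⟨hb, hb'⟩
    simp only [Set.mem_union, not_or] at ha ha' hb hb'
    exact S.no_edge a ⟨ha.resolve_right ha'.2, ha'.1⟩ b ⟨hb.resolve_right hb'.2, hb'.1⟩

/-- The `𝒮`-DAG in which `Y` is added to both sides of every separation. -/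
def SDAG.enlarge (G : SDAG D) (Y : Set V) : SDAG D where
  Node := G.Node
  finite_node := G.finite_node
  nonempty_node := G.nonempty_node
  T := G.T
  acyclic := G.acyclic
  outDegree_le := G.outDegree_le
  σ s t h := (G.σ s t h).enlarge Y
  consistent t₁ t₂ t₃ h h' :=
    ⟨Set.union_subset_union_left _ (G.consistent t₁ t₂ t₃ h h').1,
      Set.union_subset_union_left _ (G.consistent t₁ t₂ t₃ h h').2⟩

theorem SDAG.topSep_enlarge_B (G : SDAG D) (Y : Set V) (t : G.Node) :
    ((G.enlarge Y).topSep t).B = (G.topSep t).B ∪ Y := by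
  ext x
  simp only [topSep, Separation.join, enlarge, Separation.enlarge, Set.mem_iInter,
    Set.mem_ofPred_eq, Set.mem_union]
  constructor
  · intro h
    by_cases hx : x ∈ Y
    · exact .inr hx
    · left
      rintro _ ⟨p, hp, rfl⟩
      exact (h _ ⟨p, hp, rfl⟩).resolve_right hx
  · rintro h _ ⟨p, hp, rfl⟩
    exact h.imp_left fun h => h _ ⟨p, hp, rfl⟩

/-- The incoming edge matters: at a source the empty join has upper side `∅` and does not acquire
`Y`. -/
theorem SDAG.mem_topSep_enlarge_A (G : SDAG D) (Y : Set V) {s t : G.Node} (h : G.T.Adj s t)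
    {x : V} : x ∈ ((G.enlarge Y).topSep t).A ↔ x ∈ (G.topSep t).A ∨ x ∈ Y := by
  simp only [topSep, Separation.join, enlarge, Set.mem_iUnion,
    Set.mem_ofPred_eq]
  constructor
  · rintro ⟨_, ⟨p, hp, rfl⟩, hx | hx⟩
    · exact .inl ⟨_, ⟨p, hp, rfl⟩, hx⟩
    · exact .inr hx
  · rintro (⟨_, ⟨p, hp, rfl⟩, hx⟩ | hx)
    · exact ⟨_, ⟨p, hp, rfl⟩, .inl hx⟩
    · exact ⟨_, ⟨s, h, rfl⟩, .inr hx⟩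

theorem SDAG.botSep_enlarge_A (G : SDAG D) (Y : Set V) (t : G.Node) :
    ((G.enlarge Y).botSep t).A = (G.botSep t).A ∪ Y := by
  ext x
  simp only [botSep, Separation.meet, Set.mem_iInter, Set.mem_ofPred_eq, Set.mem_union]
  constructor
  · intro h
    by_cases hx : x ∈ Y
    · exact .inr hx
    · left
      rintro _ ⟨c, hc, rfl⟩
      exact ((G.mem_topSep_enlarge_A Y hc).1 (h _ ⟨c, hc, rfl⟩)).resolve_right hx
  · rintro h _ ⟨c, hc, rfl⟩
    exact (G.mem_topSep_enlarge_A Y (s := t) hc).2 (h.imp_left fun h => h _ ⟨c, hc, rfl⟩)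

theorem SDAG.bag_enlarge (G : SDAG D) (Y : Set V) (t : G.Node) :
    (G.enlarge Y).bag t = G.bag t ∪ Y := by
  unfold bag
  rw [Set.inter_union_distrib_right, ← G.botSep_enlarge_A Y t, ← G.topSep_enlarge_B Y t]

/-- Take `Y` inclusion-maximal such that the enlarged width is at most `k`. If `Y = V`, the width is
at least `|V| ≥ k`; otherwise a width below `k` would leave room for one more vertex. -/
theorem SDAG.exists_width_eq [Finite V] {k : ℕ} (G : SDAG D) (hG : G.width ≤ k)
    (hk : k ≤ Nat.card V) : ∃ G' : SDAG D, G'.width = k := by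
  obtain ⟨Y, hY, hmax⟩ := (Set.toFinite {Y : Set V | (G.enlarge Y).width ≤ k}).exists_maximal
    ⟨∅, (SDAG.width_le_iff _).2 fun t => by
      rw [G.bag_enlarge ∅ t, Set.union_empty]; exact G.width_le_iff.1 hG t⟩
  refine ⟨G.enlarge Y, hY.antisymm ?_⟩
  by_cases hu : Y = Set.univ
  · obtain ⟨t⟩ := G.nonempty_node
    have h := (SDAG.width_le_iff (G.enlarge Y)).1 le_rfl t
    rw [G.bag_enlarge, hu, Set.union_univ, Set.ncard_univ, ← hu] at h
    exact hk.trans h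
  · obtain ⟨y, hy⟩ := (Set.ne_univ_iff_exists_notMem Y).1 hu
    by_contra! hlt
    have : (G.enlarge (insert y Y)).width ≤ k := by
      refine (SDAG.width_le_iff _).2 fun t => ?_
      have h := (SDAG.width_le_iff (G.enlarge Y)).1 le_rfl t
      rw [G.bag_enlarge Y t] at h
      rw [G.bag_enlarge (insert y Y) t, Set.union_insert]
      exact (Set.ncard_insert_le _ _).trans (by omega)
    exact hy (hmax this (Set.subset_insert y Y) (Set.mem_insert y Y))

end Enlarge

/-! ### Winning positions -/

section Game

variable {V : Type v} {D : Digraph V} {k : ℕ}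

/-- The cop initiative states from which the cop player can force a win. -/
inductive CopsWinFrom (D : Digraph V) : CopState V k → Prop
  | single (p : CopState V k) (q : RobberState₁ V k) : IsSingleMove D p q →
      (∀ p', IsReply₁ D q p' → CopsWinFrom D p') → CopsWinFrom D p
  | double (p : CopState V k) (q : RobberState₂ V k) (S : V → CopPos V k) : IsDoubleMove D p q →
      (∀ w ∈ reach D q.cops.1 q.robber, IsReply₂ D q ⟨S w, w⟩) →
      (∀ w ∈ reach D q.cops.1 q.robber, CopsWinFrom D ⟨S w, w⟩) → CopsWinFrom D p

theorem IsSingleMove.reach_eq {p : CopState V k} {q : RobberState₁ V k} (h : IsSingleMove D p q) :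
    reach D q.cops.1 q.robber = reach D p.cops.1 p.robber := by
  rw [h.1, h.2.2.2.1]

theorem IsDoubleMove.reach_eq {p : CopState V k} {q : RobberState₂ V k} (h : IsDoubleMove D p q) :
    reach D q.cops.1 q.robber = reach D p.cops.1 p.robber := by
  obtain ⟨h₁, _, _, -, -, -, h₂, -⟩ := h
  rw [h₁, h₂]

/-- The conditions on a double move say exactly that the cop player is never stuck: a vertex of one
`Sᵢ` is answered by the other, since `S₁ ∩ S₂ ⊆ X_⊥`, and any other vertex by a set that shrinks the
territory. -/
theorem IsDoubleMove.exists_reply {p : CopState V k} {q : RobberState₂ V k}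
    (h : IsDoubleMove D p q) {w : V} (hw : w ∈ reach D q.cops.1 q.robber) :
    ∃ S, IsReply₂ D q ⟨S, w⟩ := by
  have he := h.reach_eq
  obtain ⟨h₁, S₁, S₂, hn, -, hI, -, h₃, h₄, h₅⟩ := h
  rw [← he] at h₃ h₄ h₅
  rw [← h₁] at h₃
  have hX := not_mem_of_mem_reach hw
  have m₁ : S₁ ∈ q.next := by simp [hn]
  have m₂ : S₂ ∈ q.next := by simp [hn]
  by_cases w₁ : w ∈ S₁.1
  · exact ⟨S₂, hw, m₂, fun w₂ => hX (hI ⟨w₁, w₂⟩), h₄ w ⟨w₁, hX⟩⟩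
  by_cases w₂ : w ∈ S₂.1
  · exact ⟨S₁, hw, m₁, w₁, h₅ w ⟨w₂, hX⟩⟩
  rcases h₃ w ⟨hw, by simp [w₁, w₂]⟩ with h | h
  · exact ⟨S₁, hw, m₁, w₁, h⟩
  · exact ⟨S₂, hw, m₂, w₂, h⟩

/-- A quantity that decreases in each round of the game. -/
noncomputable def potential (D : Digraph V) (p : CopState V k) : ℕ :=
  (k + 1) * (reach D p.cops.1 p.robber).ncard + p.cops.1.ncard

/-- The weight `k + 1` makes the loss of one reachable vertex outweigh up to `k` extra cops. -/
theorem potential_lt_of_reach [Finite V] {p p' : CopState V k}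
    (h : reach D p'.cops.1 p'.robber ⊂ reach D p.cops.1 p.robber) :
    potential D p' < potential D p := by
  have h₁ := Set.ncard_lt_ncard h (Set.toFinite _)
  have h₂ := p'.cops.2
  unfold potential
  nlinarith

/-- Either cops are only removed and the territory does not grow, or a new cop lands inside the
territory and so removes a vertex from it. -/
theorem potential_lt_single [Finite V] {p p' : CopState V k} {q : RobberState₁ V k}
    (h : IsSingleMove D p q) (h' : IsReply₁ D q p') : potential D p' < potential D p := by
  have he := h.reach_eq
  obtain ⟨-, hc, hX, -, hne⟩ := h
  obtain ⟨⟨hr, hr'⟩, hp⟩ := h'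
  have hsub : reach D p'.cops.1 p'.robber ⊆ reach D p.cops.1 p.robber := by
    rw [← he]
    refine (reach_anti ?_).trans (reach_trans hr)
    rw [hc, hp]
    exact Set.inter_subset_left
  by_cases hs : q.next.1 ⊆ p.cops.1
  · have h₁ := Set.ncard_le_ncard hsub (Set.toFinite _)
    have h₂ : p'.cops.1.ncard < p.cops.1.ncard := by
      refine Set.ncard_lt_ncard ?_ (Set.toFinite _)
      rw [hp]
      exact hs.ssubset_of_ne fun h => hne (Subtype.ext h)
    unfold potential
    nlinarith
  · obtain ⟨x, hx, hx'⟩ := Set.not_subset.1 hs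
    refine potential_lt_of_reach (hsub.ssubset_of_not_subset fun h => ?_)
    exact not_mem_of_mem_reach (h (hX ⟨hx, hx'⟩)) (hp ▸ hx)

theorem potential_lt [Finite V] {p p' : CopState V k} {q : RobberState V k}
    (h : IsCopMove D p q) (h' : IsReply D q p') : potential D p' < potential D p := by
  cases q with
  | single q => exact potential_lt_single h h'
  | double q => exact potential_lt_of_reach (IsDoubleMove.reach_eq h ▸ h'.2.2.2)

/-! ### Winning strategies and winning positions -/

/-- The robber can answer in a way that is consistent with `s` and avoids winning positions of the
cop player. -/
theorem exists_bad_reply (s : Strategy D k) {p : CopState V k} (hp : ¬ CopsWinFrom D p)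
    {q : RobberState V k} (hq : IsCopMove D p q) :
    ∃ p', IsReply D q p' ∧ ¬ CopsWinFrom D p' ∧
      ∀ q₂ S, q = .double q₂ → s.g q₂ p'.robber = some S → p'.cops = S := by
  by_contra! hcon
  cases q with
  | single q =>
    refine hp (.single p q hq fun p' hp' => ?_)
    by_contra h
    obtain ⟨_, _, h, -⟩ := hcon p' hp' h
    cases h
  | double q =>
    have : ∀ w, ∃ S, w ∈ reach D q.cops.1 q.robber →
        IsReply₂ D q ⟨S, w⟩ ∧ CopsWinFrom D ⟨S, w⟩ := by
      intro w
      by_cases hw : w ∈ reach D q.cops.1 q.robber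
      -- Where `g` is defined its value is forced, so that the resulting play is consistent.
      · have : ∃ S, IsReply₂ D q ⟨S, w⟩ ∧ ∀ S', s.g q w = some S' → S = S' := by
          rcases hg : s.g q w with _ | S
          · obtain ⟨S, hS⟩ := IsDoubleMove.exists_reply hq hw
            exact ⟨S, hS, by simp⟩
          · exact ⟨S, s.legal_g q w hw S hg, by simp⟩
        obtain ⟨S, hS, hS'⟩ := this
        refine ⟨S, fun _ => ⟨hS, ?_⟩⟩
        by_contra h
        obtain ⟨q₂, S', h, hg, hne⟩ := hcon ⟨S, w⟩ hS h
        cases h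
        exact hne (hS' S' hg)
      · exact ⟨⟨∅, by simp⟩, fun h => absurd h hw⟩
    choose S hS using this
    exact hp (.double p q S hq (fun w hw => (hS w hw).1) fun w hw => (hS w hw).2)

open Classical in
/-- One step of a play in which the robber avoids winning positions of the cop player. -/
noncomputable def avoidStep (s : Strategy D k) : GameState V k → Option (GameState V k)
  | .cop p => match s.f p with
    | some q => some (.robber q)
    | none => if h : ∃ q, IsCopMove D p q then some (.robber h.choose) else none
  | .robber q => if h : ∃ p', IsReply D q p' ∧ ¬ CopsWinFrom D p' ∧
      ∀ q₂ S, q = .double q₂ → s.g q₂ p'.robber = some S → p'.cops = S then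
      some (.cop h.choose) else none

/-- A play in which the robber avoids winning positions of the cop player. -/
noncomputable def avoidPlay (s : Strategy D k) (r : V) : ℕ → Option (GameState V k)
  | 0 => some (startState k r)
  | n + 1 => (avoidPlay s r n).bind (avoidStep s)

/-- The states from which the robber can avoid winning positions of the cop player. -/
def Avoiding (D : Digraph V) : GameState V k → Prop
  | .cop p => ¬ CopsWinFrom D p
  | .robber q => ∃ p, ¬ CopsWinFrom D p ∧ IsCopMove D p q

theorem avoidStep_robber (s : Strategy D k) {q : RobberState V k} (hq : Avoiding D (.robber q)) :
    ∃ p', avoidStep s (.robber q) = some (.cop p') ∧ IsReply D q p' ∧ ¬ CopsWinFrom D p' ∧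
      ∀ q₂ S, q = .double q₂ → s.g q₂ p'.robber = some S → p'.cops = S := by
  obtain ⟨p, hp, hpq⟩ := hq
  have h := exists_bad_reply s hp hpq
  exact ⟨h.choose, by simp only [avoidStep, dif_pos h], h.choose_spec⟩

theorem avoidStep_cop (s : Strategy D k) (p : CopState V k) :
    (∃ q, avoidStep s (.cop p) = some (.robber q) ∧ IsCopMove D p q ∧
      ∀ q', s.f p = some q' → q = q') ∨
    (avoidStep s (.cop p) = none ∧ ∀ q, ¬ IsCopMove D p q) := by
  rcases hf : s.f p with _ | q
  · by_cases h : ∃ q, IsCopMove D p q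
    · exact .inl ⟨h.choose, by simp only [avoidStep, hf, dif_pos h], h.choose_spec, by simp⟩
    · exact .inr ⟨by simp only [avoidStep, hf, dif_neg h], not_exists.1 h⟩
  · exact .inl ⟨q, by simp only [avoidStep, hf], s.legal_f p q hf, by simp⟩

theorem avoiding_avoidPlay (s : Strategy D k) {r : V}
    (hr : ¬ CopsWinFrom D (⟨⟨∅, by simp⟩, r⟩ : CopState V k)) :
    ∀ n a, avoidPlay s r n = some a → Avoiding D a := by
  intro n
  induction n with
  | zero =>
    rintro a ⟨⟩
    exact hr
  | succ n ih =>
    intro a ha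
    obtain ⟨b, hb, hba⟩ := Option.bind_eq_some_iff.1 ha
    have hb := ih b hb
    rcases b with p | q
    · rcases avoidStep_cop s p with ⟨q, hq, hm, -⟩ | ⟨h, -⟩
      · cases hq.symm.trans hba
        exact ⟨p, hb, hm⟩
      · cases h.symm.trans hba
    · obtain ⟨p', h, -, h', -⟩ := avoidStep_robber s hb
      cases h.symm.trans hba
      exact h'

/-- From a non-winning start, a robber who keeps to non-winning states always has a reply, so some
consistent play never ends at a robber initiative state. -/
theorem CopsWin.copsWinFrom (h : CopsWin D k) (r : V) :
    CopsWinFrom D (⟨⟨∅, by simp⟩, r⟩ : CopState V k) := by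
  obtain ⟨s, hs⟩ := h
  by_contra hr
  have hav := avoiding_avoidPlay s hr
  have hsucc : ∀ n a, avoidPlay s r n = some a → avoidPlay s r (n + 1) = avoidStep s a :=
    fun n a h => by simp only [avoidPlay, h, Option.bind_some]
  obtain ⟨n, q, hq, hq'⟩ := hs (avoidPlay s r)
    { start := ⟨r, rfl⟩
      step := by
        intro n a b ha hb
        rw [hsucc n a ha] at hb
        rcases a with p | q
        · rcases avoidStep_cop s p with ⟨q, hq, hm, -⟩ | ⟨h, -⟩
          · cases hq.symm.trans hb
            exact hm
          · cases h.symm.trans hb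
        · obtain ⟨p', h, h', -⟩ := avoidStep_robber s (hav n _ ha)
          cases h.symm.trans hb
          exact h'
      maximal := by
        intro n a ha hb b hab
        rw [hsucc n a ha] at hb
        rcases a with p | q
        · rcases avoidStep_cop s p with ⟨q, hq, -⟩ | ⟨-, h⟩
          · cases hq.symm.trans hb
          · rcases b with _ | q
            · exact hab
            · exact h q hab
        · obtain ⟨p', h, -⟩ := avoidStep_robber s (hav n _ ha)
          cases h.symm.trans hb
      ended := fun n h => by simp only [avoidPlay, h, Option.bind_none] }
    { follows_f := by
        intro n p q hp hf
        rw [hsucc n _ hp]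
        rcases avoidStep_cop s p with ⟨q', hq, -, h⟩ | ⟨-, h⟩
        · rw [hq, h q hf]
        · exact absurd (s.legal_f p q hf) (h q)
      follows_g := by
        intro n q p S hq hp hg
        rw [hsucc n _ hq] at hp
        obtain ⟨p', h, -, -, h'⟩ := avoidStep_robber s (hav n _ hq)
        cases h.symm.trans hp
        exact h' q S rfl hg }
  obtain ⟨p', h, -⟩ := avoidStep_robber s (hav n _ hq)
  rw [hsucc n _ hq, h] at hq'
  cases hq'

/-- The robber initiative state `q` is good for the cop player, who can answer every choice of the
robber so as to reach a winning position. -/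
def RobberState.Forced (D : Digraph V) : RobberState V k → Prop
  | .single q => ∀ p', IsReply₁ D q p' → CopsWinFrom D p'
  | .double q => ∀ w ∈ reach D q.cops.1 q.robber, ∃ S, IsReply₂ D q ⟨S, w⟩ ∧ CopsWinFrom D ⟨S, w⟩

theorem CopsWinFrom.exists_move {p : CopState V k} (h : CopsWinFrom D p) :
    ∃ q, IsCopMove D p q ∧ q.Forced D := by
  cases h with
  | single _ q hm h => exact ⟨.single q, hm, h⟩
  | double _ q S hm h h' => exact ⟨.double q, hm, fun w hw => ⟨S w, h w hw, h' w hw⟩⟩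

open Classical in
/-- The strategy that stays in winning positions. -/
noncomputable def winningStrategy (D : Digraph V) (k : ℕ) : Strategy D k where
  f p := if h : ∃ q, IsCopMove D p q ∧ q.Forced D then some h.choose else none
  g q w := if h : ∃ S, IsReply₂ D q ⟨S, w⟩ ∧ CopsWinFrom D ⟨S, w⟩ then some h.choose else none
  legal_f p q h := by
    split_ifs at h with h'
    cases h
    exact h'.choose_spec.1
  legal_g q w _ S h := by
    split_ifs at h with h'
    cases h
    exact h'.choose_spec.1

/-- A consistent play stays in winning positions, where `f` is defined, while the potential drops
each round; it must therefore stop, and does so on the robber's turn. -/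
theorem winningStrategy_winning [Finite V]
    (h : ∀ r, CopsWinFrom D (⟨⟨∅, by simp⟩, r⟩ : CopState V k)) :
    (winningStrategy D k).Winning := by
  intro π hπ hc
  have main : ∀ (m n : ℕ) (p : CopState V k), potential D p < m → π n = some (.cop p) →
      CopsWinFrom D p → CopsWinPlay π := by
    intro m
    induction m with
    | zero => simp
    | succ m ih =>
      intro n p hm hp hw
      have hq := hw.exists_move
      have h₁ := hc.follows_f n p hq.choose hp (by simp only [winningStrategy, dif_pos hq])
      obtain ⟨hmove, hforced⟩ := hq.choose_spec
      generalize hq.choose = q at h₁ hmove hforced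
      rcases h₂ : π (n + 1 + 1) with _ | a
      · exact ⟨n + 1, q, h₁, h₂⟩
      · have hstep := hπ.step _ _ _ h₁ h₂
        rcases a with p' | q'
        · refine ih (n + 1 + 1) p' ?_ h₂ ?_
          · have := potential_lt hmove hstep
            omega
          · rcases q with q | q
            · exact hforced p' hstep
            · have hS := hforced p'.robber hstep.1
              have := hc.follows_g (n + 1) q p' hS.choose h₁ h₂
                (by simp only [winningStrategy, dif_pos hS])
              have hwin := hS.choose_spec.2
              rw [← this] at hwin
              exact hwin
        · exact hstep.elim
  obtain ⟨r, hr⟩ := hπ.start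
  exact main _ 0 _ (Nat.lt_succ_self _) hr (h r)

theorem copsWin_iff [Finite V] :
    CopsWin D k ↔ ∀ r, CopsWinFrom D (⟨⟨∅, by simp⟩, r⟩ : CopState V k) :=
  ⟨fun h => h.copsWinFrom, fun h => ⟨_, winningStrategy_winning h⟩⟩

/-! ### Winning positions from decompositions -/

/-- The robber is confined to the complement of `A` by cops in `A`. -/
structure Confined (D : Digraph V) (A : Set V) (p : CopState V k) : Prop where
  not_mem : p.robber ∉ p.cops.1
  disjoint : ∀ x ∈ reach D p.cops.1 p.robber, x ∉ A
  boundary : outBoundary D (reach D p.cops.1 p.robber) ⊆ A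

/-- While the territory `R` avoids `S.A` and its boundary `N` lies in the bag, the cops can play
inside this node: withdraw to `N`, then occupy the bag within `R ∪ N`. Once `R` misses `S₁.A ∩
S₂.A`, they either pass directly to a child that `R` respects or split with a double move. Induction
on the potential covers repeated rounds. -/
theorem copsWinFrom_of_node [Finite V] {S S₁ S₂ : Separation D}
    (hb : (S₁.A ∩ S₂.A ∩ S.B).ncard ≤ k)
    (ho₁ : (S₁.A ∩ S₁.B).ncard ≤ k) (ho₂ : (S₂.A ∩ S₂.B).ncard ≤ k)
    (ih₁ : ∀ p : CopState V k, Confined D S₁.A p → CopsWinFrom D p)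
    (ih₂ : ∀ p : CopState V k, Confined D S₂.A p → CopsWinFrom D p)
    (p : CopState V k) (hr : p.robber ∉ p.cops.1)
    (hR : ∀ x ∈ reach D p.cops.1 p.robber, x ∉ S.A)
    (hN : outBoundary D (reach D p.cops.1 p.robber) ⊆ S₁.A ∩ S₂.A ∩ S.B) :
    CopsWinFrom D p := by
  induction hm : potential D p using Nat.strong_induction_on generalizing p with
  | _ m ih =>
  subst hm
  obtain ⟨X, r⟩ := p
  dsimp only at hr hR hN
  set R := reach D X.1 r with hRdef
  set N := outBoundary D R with hNdef
  have hNX : N ⊆ X.1 := outBoundary_reach_subset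
  have hrR : r ∈ R := mem_reach_self hr
  have hsub : ∀ {Y : Set V} {w}, N ⊆ Y → w ∈ R → reach D Y w ⊆ R :=
    fun hY hw => reach_subset_of_mem hw hY
  by_cases hXN : X.1 = N
  swap
  · have hNk : N.ncard ≤ k := (Set.ncard_le_ncard hNX (Set.toFinite _)).trans X.2
    have he : R = reach D N r := reach_eq_of_outBoundary_subset hr hNX subset_rfl
    have hmove : IsSingleMove D ⟨X, r⟩ (⟨r, ⟨N, hNk⟩, ⟨N, hNk⟩⟩ : RobberState₁ V k) :=
      ⟨rfl, (Set.inter_eq_left.2 hNX).symm, fun x hx => absurd (hNX hx.1) hx.2, he,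
        fun h => hXN (congrArg Subtype.val h).symm⟩
    refine .single _ _ hmove fun p' hp' => ih _ (potential_lt_single hmove hp') p' ?_ ?_ ?_ rfl
    all_goals
      obtain ⟨⟨h₁, h₂⟩, h₃⟩ := hp'
      obtain ⟨_, r'⟩ := p'
      dsimp only at h₁ h₂ h₃ ⊢
      subst h₃
    · exact h₂
    · exact fun x hx => hR x (hsub subset_rfl (he ▸ h₁) hx)
    · exact outBoundary_reach_subset.trans hN
  have hNR : ∀ x ∈ R, x ∉ N := fun x hx h => h.1 hx
  by_cases hA : ∃ x ∈ R, x ∈ S₁.A ∧ x ∈ S₂.A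
  · obtain ⟨x, hxR, hxA⟩ := hA
    have hXb : S₁.A ∩ S₂.A ∩ (R ∪ N) ⊆ S₁.A ∩ S₂.A ∩ S.B := by
      rintro y ⟨hy, hy' | hy'⟩
      · exact ⟨hy, S.mem_B_of_not_mem_A (hR y hy')⟩
      · exact hN hy'
    have hNb : N ⊆ S₁.A ∩ S₂.A ∩ (R ∪ N) := fun y hy => ⟨(hN hy).1, .inr hy⟩
    have hmove : IsSingleMove D ⟨X, r⟩ (⟨r, X, ⟨S₁.A ∩ S₂.A ∩ (R ∪ N),
        (Set.ncard_le_ncard hXb (Set.toFinite _)).trans hb⟩⟩ : RobberState₁ V k) := by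
      refine ⟨rfl, ?_, ?_, rfl, fun h => ?_⟩
      · exact (Set.inter_eq_right.2 (hXN.subset.trans hNb)).symm
      · exact fun y hy => hy.1.2.resolve_right (fun h => hy.2 (hNX h))
      · have : x ∈ X.1 := (congrArg Subtype.val h : _ = X.1) ▸ ⟨hxA, .inl hxR⟩
        exact not_mem_of_mem_reach hxR this
    refine .single _ _ hmove fun p' hp' => ih _ (potential_lt_single hmove hp') p' ?_ ?_ ?_ rfl
    all_goals
      obtain ⟨⟨h₁, h₂⟩, h₃⟩ := hp'
      obtain ⟨_, r'⟩ := p'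
      dsimp only at h₁ h₂ h₃ ⊢
      subst h₃
    · exact h₂
    · exact fun x hx => hR x (hsub hNb h₁ hx)
    · exact outBoundary_reach_subset.trans hXb
  push Not at hA
  by_cases hA₁ : ∀ x ∈ R, x ∉ S₁.A
  · exact ih₁ _ ⟨hr, hA₁, fun x hx => (hN hx).1.1⟩
  by_cases hA₂ : ∀ x ∈ R, x ∉ S₂.A
  · exact ih₂ _ ⟨hr, hA₂, fun x hx => (hN hx).1.2⟩
  push Not at hA₁ hA₂
  -- An edge leaving the complement of `S'.A` ends in `S'.B`, so cops on `S'.A ∩ S'.B` keep the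
  -- robber out of `S'.A`; the containment is strict because `R` meets `S'.A`.
  have side : ∀ (S' : Separation D), N ⊆ S'.A → (∃ x ∈ R, x ∈ S'.A) → ∀ w ∈ R, w ∉ S'.A →
      (∀ x ∈ reach D (S'.A ∩ S'.B ∩ (R ∪ N)) w, x ∈ R ∧ x ∉ S'.A) ∧
      reach D (S'.A ∩ S'.B ∩ (R ∪ N)) w ⊂ R := by
    intro S' hS' hex w hw hwA
    have h : reach D (S'.A ∩ S'.B ∩ (R ∪ N)) w ⊆ R \ S'.A := by
      refine reach_subset ⟨hw, hwA⟩ fun u hu x ha => ?_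
      have hxB := S'.mem_B_of_adj hu.2 ha
      by_cases hxR : x ∈ R
      · by_cases hxA : x ∈ S'.A
        · exact .inr ⟨⟨hxA, hxB⟩, .inl hxR⟩
        · exact .inl ⟨hxR, hxA⟩
      · have hxN : x ∈ N := ⟨hxR, u, hu.1, ha⟩
        exact .inr ⟨⟨hS' hxN, hxB⟩, .inr hxN⟩
    obtain ⟨x, hx, hxA⟩ := hex
    exact ⟨h, (h.trans Set.sdiff_subset).ssubset_of_not_subset fun h' => (h (h' hx)).2 hxA⟩
  have side₁ := side S₁ (fun x hx => (hN hx).1.1) hA₁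
  have side₂ := side S₂ (fun x hx => (hN hx).1.2) hA₂
  have hk : ∀ S' : Separation D, (S'.A ∩ S'.B).ncard ≤ k →
      (S'.A ∩ S'.B ∩ (R ∪ N)).ncard ≤ k := fun S' h =>
    (Set.ncard_le_ncard Set.inter_subset_left (Set.toFinite _)).trans h
  set T₁ : CopPos V k := ⟨_, hk S₁ ho₁⟩ with hT₁
  set T₂ : CopPos V k := ⟨_, hk S₂ ho₂⟩ with hT₂
  -- An in-neighbour in `R` avoids some `Sᵢ.A`, which forces the boundary vertex into `Sᵢ.B`. Thus
  -- no cop leaves and `X_⊥ = X`.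
  have hNT : N ⊆ T₁.1 ∪ T₂.1 := by
    intro x hx
    obtain ⟨u, hu, ha⟩ := hx.2
    by_cases hu₁ : u ∈ S₁.A
    · exact .inr ⟨⟨(hN hx).1.2, S₂.mem_B_of_adj (hA u hu hu₁) ha⟩, .inr hx⟩
    · exact .inl ⟨⟨(hN hx).1.1, S₁.mem_B_of_adj hu₁ ha⟩, .inr hx⟩
  have hTT : T₁.1 ∩ T₂.1 ⊆ N := by
    rintro x ⟨⟨⟨h₁, -⟩, h⟩, ⟨⟨h₂, -⟩, -⟩⟩
    exact h.resolve_left fun h => hA x h h₁ h₂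
  -- Equal sets would both be `N`, which leaves the territory unchanged and contradicts the
  -- strictness in `side`.
  have hne : T₁ ≠ T₂ := by
    intro h
    have hT : T₁.1 = N := by
      refine subset_antisymm ?_ ?_
      · rw [← h, Set.inter_self] at hTT
        exact hTT
      · rw [← h, Set.union_self] at hNT
        exact hNT
    have hR' : R = reach D N r := by rw [hRdef, hXN]
    by_cases hr₁ : r ∈ S₁.A
    · have := (side₂ r hrR (hA r hrR hr₁)).2
      change reach D T₂.1 r ⊂ R at this
      rw [← h, hT, ← hR'] at this
      exact this.ne rfl
    · have := (side₁ r hrR hr₁).2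
      change reach D T₁.1 r ⊂ R at this
      rw [hT, ← hR'] at this
      exact this.ne rfl
  have hmove : IsDoubleMove D ⟨X, r⟩
      (⟨r, X, {T₁, T₂}, Set.ncard_pair hne⟩ : RobberState₂ V k) := by
    refine ⟨rfl, T₁, T₂, rfl, ?_, ?_, rfl, ?_, ?_, ?_⟩
    · exact (Set.inter_eq_left.2 (hXN.subset.trans hNT)).symm
    · exact hTT.trans hNX
    · rintro w ⟨hw, -⟩
      by_cases hw₁ : w ∈ S₁.A
      · exact .inr (side₂ w hw (hA w hw hw₁)).2
      · exact .inl (side₁ w hw hw₁).2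
    · rintro w ⟨⟨⟨hw₁, -⟩, h⟩, hw⟩
      have hwR : w ∈ R := h.resolve_right fun h => hw (hNX h)
      exact (side₂ w hwR (hA w hwR hw₁)).2
    · rintro w ⟨⟨⟨hw₂, -⟩, h⟩, hw⟩
      have hwR : w ∈ R := h.resolve_right fun h => hw (hNX h)
      exact (side₁ w hwR fun hw₁ => hA w hwR hw₁ hw₂).2
  classical
  refine .double _ _ (fun w => if w ∈ S₁.A then T₂ else T₁) hmove ?_ ?_
  · intro w hw
    by_cases hw₁ : w ∈ S₁.A
    · simp only [if_pos hw₁]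
      exact ⟨hw, .inr rfl, fun h => hA w hw hw₁ h.1.1, (side₂ w hw (hA w hw hw₁)).2⟩
    · simp only [if_neg hw₁]
      exact ⟨hw, .inl rfl, fun h => hw₁ h.1.1, (side₁ w hw hw₁).2⟩
  · intro w hw
    by_cases hw₁ : w ∈ S₁.A
    · simp only [if_pos hw₁]
      exact ih₂ _ ⟨fun h => hA w hw hw₁ h.1.1,
        fun x hx => ((side₂ w hw (hA w hw hw₁)).1 x hx).2,
        outBoundary_reach_subset.trans fun x hx => hx.1.1⟩
    · simp only [if_neg hw₁]
      exact ih₁ _ ⟨fun h => hw₁ h.1.1, fun x hx => ((side₁ w hw hw₁).1 x hx).2,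
        outBoundary_reach_subset.trans fun x hx => hx.1.1⟩

theorem Decomposable.copsWinFrom [Finite V] {S : Separation D} (h : Decomposable k S)
    (p : CopState V k) (hp : Confined D S.A p) : CopsWinFrom D p := by
  induction h generalizing p with
  | last => exact (hp.disjoint _ (mem_reach_self hp.not_mem) trivial).elim
  | node S S₁ S₂ h₁ h₂ d₁ d₂ hb ih₁ ih₂ =>
    refine copsWinFrom_of_node (S := S) hb d₁.order_le d₂.order_le ih₁ ih₂ p hp.not_mem
      hp.disjoint ?_
    intro x hx
    obtain ⟨u, hu, ha⟩ := hx.2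
    exact ⟨⟨h₁.1 (hp.boundary hx), h₂.1 (hp.boundary hx)⟩,
      S.mem_B_of_adj (hp.disjoint u hu) ha⟩

/-! ### Decompositions from winning positions -/

/-- Territories are split off one at a time: the children are one piece and the union of the rest,
and what belongs to neither piece lies in `X`. -/
theorem decomposable_of_cover [Finite V] {X : Set V} (hk : X.ncard ≤ k) (W : Set V)
    (h : ∀ w ∈ W, Decomposable k
      (Separation.ofRegion (D := D) (reach D X w) X outBoundary_reach_subset))
    (U : Set V) (hU : outBoundary D U ⊆ X) (hUW : U = ⋃ w ∈ W, reach D X w) :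
    Decomposable k (Separation.ofRegion U X hU) := by
  induction W, Set.toFinite W using Set.Finite.induction_on generalizing U with
  | empty =>
    have : U = ∅ := by simpa using hUW
    subst this
    refine .single (Separation.le_last _) .last ?_
    simpa [Separation.last, Separation.ofRegion] using hk
  | @insert a W _ _ ih =>
    have hU' : outBoundary D (⋃ w ∈ W, reach D X w) ⊆ X := by
      rintro x ⟨hx, u, hu, ha⟩
      by_contra hxX
      obtain ⟨w, hw, hu⟩ := Set.mem_iUnion₂.1 hu
      exact hx (Set.mem_iUnion₂.2 ⟨w, hw, reach_closed hu ha hxX⟩)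
    rw [Set.biUnion_insert] at hUW
    subst hUW
    refine .node _ _ _ ?_ ?_ (h a (Set.mem_insert _ _))
      (ih (fun w hw => h w (Set.mem_insert_of_mem _ hw)) _ hU' rfl) ?_
    · exact ⟨Set.compl_subset_compl.2 Set.subset_union_left,
        Set.union_subset_union_left _ Set.subset_union_left⟩
    · exact ⟨Set.compl_subset_compl.2 Set.subset_union_right,
        Set.union_subset_union_left _ Set.subset_union_right⟩
    · refine (Set.ncard_le_ncard ?_ (Set.toFinite _)).trans hk
      rintro x ⟨⟨h₁, h₂⟩, (h | h) | h⟩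
      · exact absurd h h₁
      · exact absurd h h₂
      · exact h

/-- Cops that do not restrict the robber may be removed. -/
theorem Decomposable.of_subset [Finite V] {U X Y : Set V} (hk : X.ncard ≤ k) (hYX : Y ⊆ X)
    (hY : outBoundary D U ⊆ Y) (h : Decomposable k (Separation.ofRegion U Y hY))
    (hX : outBoundary D U ⊆ X) : Decomposable k (Separation.ofRegion U X hX) := by
  have hle : Separation.ofRegion U X hX ≤ Separation.ofRegion U Y hY :=
    ⟨subset_rfl, Set.union_subset_union_right _ hYX⟩
  refine .single hle h ?_
  refine (Set.ncard_le_ncard ?_ (Set.toFinite _)).trans hk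
  rintro x ⟨h₁, h₂⟩
  exact h₂.resolve_left h₁

/-- After reducing `X` to `X_⊥`, a single move gives one child, of region `R \ X'`, and a double
move two children, each collecting the territories of the vertices answered by one `Sᵢ`. -/
theorem CopsWinFrom.decomposable [Finite V] {p : CopState V k} (h : CopsWinFrom D p) :
    Decomposable k (Separation.ofRegion (D := D) (reach D p.cops.1 p.robber) p.cops.1
      outBoundary_reach_subset) := by
  induction h with
  | single p q hm _ ih =>
    have he := hm.reach_eq
    obtain ⟨-, hc, hX, -, -⟩ := hm
    -- Making the territory a variable allows rewriting despite the boundary proof inside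
    -- `ofRegion`.
    suffices ∀ R hX, R = reach D p.cops.1 p.robber →
        Decomposable k (Separation.ofRegion (D := D) R p.cops.1 hX) from this _ _ rfl
    intro R hpX hR
    rw [← hR] at he hX
    have hRq : outBoundary D R ⊆ q.cops.1 := he ▸ outBoundary_reach_subset
    have hqp : q.cops.1 ⊆ p.cops.1 := hc ▸ Set.inter_subset_right
    have hqn : q.cops.1 ⊆ q.next.1 := hc ▸ Set.inter_subset_left
    have hU : outBoundary D (R \ q.next.1) ⊆ q.next.1 := by
      rintro x ⟨hx, u, hu, ha⟩
      by_contra hxn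
      have hxR : x ∉ R := fun h => hx ⟨h, hxn⟩
      exact hxn (hqn (hRq ⟨hxR, u, hu.1, ha⟩))
    refine Decomposable.of_subset p.cops.2 hqp hRq ?_ _
    have hd : Decomposable k (Separation.ofRegion (R \ q.next.1) q.next.1 hU) := by
      refine decomposable_of_cover q.next.2 (R \ q.next.1) ?_ _ _ ?_
      · exact fun w hw => ih ⟨q.next, w⟩ ⟨by rw [he]; exact hw, rfl⟩
      · refine subset_antisymm (fun w hw => Set.mem_iUnion₂.2 ⟨w, hw, mem_reach_self hw.2⟩) ?_
        exact Set.iUnion₂_subset fun w hw => reach_subset_of_mem hw hU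
    refine .single ⟨?_, ?_⟩ hd ?_
    · exact Set.compl_subset_compl.2 Set.sdiff_subset
    · rintro x (hx | hx)
      · exact .inl hx.1
      · by_cases hxp : x ∈ p.cops.1
        · exact .inr (hc ▸ ⟨hx, hxp⟩)
        · exact .inl (hX ⟨hx, hxp⟩)
    · refine (Set.ncard_le_ncard ?_ (Set.toFinite _)).trans q.next.2
      rintro x ⟨h₁, h₂ | h₂⟩
      · by_contra h
        exact h₁ ⟨h₂, h⟩
      · exact hqn h₂
  | double p q S hm hS _ ih =>
    have he := hm.reach_eq
    obtain ⟨-, S₁, S₂, hn, hc, hI, -, -, h₁, h₂⟩ := hm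
    suffices ∀ R hX, R = reach D p.cops.1 p.robber →
        Decomposable k (Separation.ofRegion (D := D) R p.cops.1 hX) from this _ _ rfl
    intro R hpX hR
    rw [← hR] at he h₁ h₂
    have hRq : outBoundary D R ⊆ q.cops.1 := he ▸ outBoundary_reach_subset
    have hqp : q.cops.1 ⊆ p.cops.1 := hc ▸ Set.inter_subset_left
    refine Decomposable.of_subset p.cops.2 hqp hRq ?_ _
    rw [he] at hS ih
    have hS' : ∀ w ∈ R, reach D (S w).1 w ⊆ R := fun w hw => he ▸ (hS w hw).2.2.2.1
    have part : ∀ T : CopPos V k, T.1 ⊆ R ∪ q.cops.1 →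
        ∃ C : Separation D, Decomposable k C ∧
          Separation.ofRegion R q.cops.1 hRq ≤ C ∧ ∀ w ∈ R, S w = T → w ∉ C.A := by
      intro T hT
      have hU : outBoundary D (⋃ w ∈ {w ∈ R | S w = T}, reach D T.1 w) ⊆ T.1 := by
        rintro x ⟨hx, u, hu, ha⟩
        by_contra hxX
        obtain ⟨w, hw, hu⟩ := Set.mem_iUnion₂.1 hu
        exact hx (Set.mem_iUnion₂.2 ⟨w, hw, reach_closed hu ha hxX⟩)
      have hUR : (⋃ w ∈ {w ∈ R | S w = T}, reach D T.1 w) ⊆ R := by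
        refine Set.iUnion₂_subset ?_
        rintro w ⟨hw, rfl⟩
        exact hS' w hw
      refine ⟨_, decomposable_of_cover T.2 {w ∈ R | S w = T} ?_ _ hU rfl,
        ⟨Set.compl_subset_compl.2 hUR, Set.union_subset (hUR.trans Set.subset_union_left) hT⟩, ?_⟩
      · rintro w ⟨hw, rfl⟩
        exact ih w hw
      · rintro w hw rfl h
        exact h (Set.mem_iUnion₂.2 ⟨w, ⟨hw, rfl⟩, mem_reach_self (hS w hw).2.2.1⟩)
    -- A new cop `x` of `S₁` is not in `S₂`, so it belongs to its own territory behind `S₂`, hence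
    -- to `R`.
    obtain ⟨C₁, d₁, l₁, m₁⟩ := part S₁ fun x hx => by
      by_cases hxq : x ∈ q.cops.1
      · exact .inr hxq
      · exact .inl ((h₁ x ⟨hx, hxq⟩).1 (mem_reach_self fun hx' => hxq (hI ⟨hx, hx'⟩)))
    obtain ⟨C₂, d₂, l₂, m₂⟩ := part S₂ fun x hx => by
      by_cases hxq : x ∈ q.cops.1
      · exact .inr hxq
      · exact .inl ((h₂ x ⟨hx, hxq⟩).1 (mem_reach_self fun hx' => hxq (hI ⟨hx', hx⟩)))
    refine .node _ C₁ C₂ l₁ l₂ d₁ d₂ ((Set.ncard_le_ncard ?_ (Set.toFinite _)).trans q.cops.2)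
    -- Every vertex of `R` is answered by `S₁` or `S₂` and so avoids `C₁.A` or `C₂.A`; only `X_⊥`
    -- can remain in the bag.
    rintro x ⟨⟨x₁, x₂⟩, hx | hx⟩
    · have hmem := (hS x hx).2.1
      rw [hn] at hmem
      rcases hmem with h | h
      · exact absurd x₁ (m₁ x hx h)
      · exact absurd x₂ (m₂ x hx h)
    · exact hx

/-- With no cops placed, the territories of all starting vertices cover `V`, and `first D` is the
region separation of `V`; conversely every start is confined by the empty set. -/
theorem copsWinFrom_iff_decomposable [Finite V] :
    (∀ r, CopsWinFrom D (⟨⟨∅, by simp⟩, r⟩ : CopState V k)) ↔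
      Decomposable k (Separation.first D) := by
  constructor
  · intro h
    have hU : outBoundary D (Set.univ : Set V) ⊆ ∅ := fun x hx => hx.1 trivial
    have : Separation.first D = Separation.ofRegion Set.univ ∅ hU := by
      ext x <;> simp [Separation.first, Separation.ofRegion]
    rw [this]
    refine decomposable_of_cover (X := ∅) (by simp) Set.univ (fun w _ => (h w).decomposable) _ _ ?_
    exact (Set.eq_univ_of_forall fun w =>
      Set.mem_iUnion₂.2 ⟨w, trivial, mem_reach_self (by simp)⟩).symm
  · intro h r
    refine h.copsWinFrom _ ⟨by simp, fun _ _ => by simp [Separation.first], ?_⟩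
    exact outBoundary_reach_subset.trans (Set.empty_subset _)

end Game

end SepDag

theorem mainTheorem3 {V : Type*} [Finite V] (D : Digraph V) (k : ℕ) :
    (SepDag.CopsWin D k ↔ ∃ G : SepDag.SDAG D, G.width ≤ k) ∧
    (k ≤ Nat.card V → (SepDag.CopsWin D k ↔ ∃ G : SepDag.SDAG D, G.width = k)) := by
  have h : SepDag.CopsWin D k ↔ ∃ G : SepDag.SDAG D, G.width ≤ k := by
    rw [SepDag.copsWin_iff, SepDag.copsWinFrom_iff_decomposable, SepDag.exists_sdag_width_le_iff]
  refine ⟨h, fun hk => h.trans ⟨?_, ?_⟩⟩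
  · rintro ⟨G, hG⟩
    exact G.exists_width_eq hG hk
  · rintro ⟨G, hG⟩
    exact ⟨G, hG.le⟩
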